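/- Let $n\ge 0$ be an integer and let $k=(k_1,\dots,k_n)$ be a family of even natural numbers. Write $S_{k_j}=S_{k_j}(SL_2(\mathbb Z))$ for the complex vector space of cusp forms of weight $k_j$ and level one, $\mathfrak S_n$ for the group of permutations of $\{1,\dots,n\}$, $B_k=\{m\in\mathbb Z^n : 1\le m_j\le k_j-1 \text{ for all } j\}$, and $V_k$ for the space of polynomials $P\in\mathbb C[X_1,\dots,X_n]$ with $\deg_{X_j}P\le k_j-2$ for all $j$. For $f_j\in S_{k_j}$ and $s\in\mathbb C^n$ put $$\Lambda(f_1,\dots,f_n;s_1,\dots,s_n)=\int_{0<t_1<\dots<t_n}\prod_{j=1}^n f_j(it_j)\,t_j^{s_j-1}\,dt_1\cdots dt_n,$$ $$P_{f_1,\dots,f_n}(X_1,\dots,X_n)=\int_{0<t_1<\dots<t_n}\prod_{j=1}^n f_j(it_j)(X_j-it_j)^{k_j-2}\,dt_1\cdots dt_n,$$ and for $\sigma\in\mathfrak S_n$ put $$\Lambda^\sigma(f_1,\dots,f_n;s_1,\dots,s_n)=\Lambda(f_{\sigma(1)},\dots,f_{\sigma(n)};s_{\sigma(1)},\dots,s_{\sigma(n)}),$$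 $$P^\sigma_{f_1,\dots,f_n}(X_1,\dots,X_n)=P_{f_{\sigma(1)},\dots,f_{\sigma(n)}}(X_{\sigma(1)},\dots,X_{\sigma(n)}).$$ All these integrals converge absolutely (the polynomial-valued ones coefficient by coefficient), $P^\sigma_{f_1,\dots,f_n}\in V_k$, and there are well-defined $\mathbb C$-linear maps $$\bigotimes_{j=1}^n S_{k_j}\to \mathbb C^{\mathfrak S_n}\otimes\mathbb C^{B_k},\qquad f_1\otimes\cdots\otimes f_n\mapsto\bigl(\Lambda^\sigma(f_1,\dots,f_n;m_1,\dots,m_n)\bigr)_{\sigma\in\mathfrak S_n,\ m\in B_k},$$ $$R_k:\bigotimes_{j=1}^n S_{k_j}\to (V_k)^{\mathfrak S_n},\qquad f_1\otimes\cdots\otimes f_n\mapsto\bigl(P^\sigma_{f_1,\dots,f_n}\bigr)_{\sigma\in\mathfrak S_n}.$$ Both maps are injective. -/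

import Mathlib

open scoped MatrixGroups TensorProduct

noncomputable section

/-- The space `S_k(SL₂(ℤ))` of holomorphic cusp forms of weight `k` and level one. -/
abbrev LevelOneCuspForm (k : ℕ) : Type := CuspForm 𝒮ℒ (k : ℤ)

/-- The value `f(it)` of a cusp form on the imaginary half-axis (used only for `t > 0`;
`UpperHalfPlane.ofComplex` is the identity on the upper half-plane). -/
def imAxisValue {k : ℕ} (f : LevelOneCuspForm k) (t : ℝ) : ℂ :=
  f (UpperHalfPlane.ofComplex (Complex.I * (t : ℂ)))

/-- The domain of integration `0 < t₁ < ⋯ < tₙ`. -/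
def openChamber (n : ℕ) : Set (Fin n → ℝ) :=
  {t | (∀ j, 0 < t j) ∧ StrictMono t}

/-- The integrand `f₁(it₁) t₁^{s₁-1} ⋯ fₙ(itₙ) tₙ^{sₙ-1}` of the iterated Mellin transform. -/
def mellinIntegrand {n : ℕ} (k : Fin n → ℕ) (f : ∀ j, LevelOneCuspForm (k j))
    (s : Fin n → ℂ) (t : Fin n → ℝ) : ℂ :=
  ∏ j, imAxisValue (f j) (t j) * (t j : ℂ) ^ (s j - 1)

/-- The iterated Mellin transform `Λ(f₁, …, fₙ; s₁, …, sₙ)`. -/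
def iteratedLambda {n : ℕ} (k : Fin n → ℕ) (f : ∀ j, LevelOneCuspForm (k j))
    (s : Fin n → ℂ) : ℂ :=
  ∫ t in openChamber n, mellinIntegrand k f s t

/-- `Λ^σ(f₁, …, fₙ; s₁, …, sₙ) = Λ(f_{σ(1)}, …, f_{σ(n)}; s_{σ(1)}, …, s_{σ(n)})`. -/
def permutedLambda {n : ℕ} (k : Fin n → ℕ) (f : ∀ j, LevelOneCuspForm (k j))
    (σ : Equiv.Perm (Fin n)) (s : Fin n → ℂ) : ℂ :=
  iteratedLambda (fun j => k (σ j)) (fun j => f (σ j)) (fun j => s (σ j))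

/-- The set `B_k` of critical multi-integers: `1 ≤ m_j ≤ k_j - 1` for all `j`. -/
abbrev CriticalIndex {n : ℕ} (k : Fin n → ℕ) : Type :=
  {m : Fin n → ℕ // ∀ j, 1 ≤ m j ∧ m j + 1 ≤ k j}

/-- The space `V_k` of polynomials in `X₁, …, Xₙ` over `ℂ` whose degree in `X_j` is at most
`k_j - 2` for all `j`. -/
def multiperiodSpace {n : ℕ} (k : Fin n → ℕ) : Submodule ℂ (MvPolynomial (Fin n) ℂ) :=
  MvPolynomial.restrictSupport ℂ {α | ∀ j, α j + 2 ≤ k j}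

/-- The polynomial `f₁(it₁) (X₁ - it₁)^{k₁-2} ⋯ fₙ(itₙ) (Xₙ - itₙ)^{kₙ-2}`. -/
def periodIntegrand {n : ℕ} (k : Fin n → ℕ) (f : ∀ j, LevelOneCuspForm (k j))
    (t : Fin n → ℝ) : MvPolynomial (Fin n) ℂ :=
  ∏ j, (MvPolynomial.C (imAxisValue (f j) (t j)) *
    (MvPolynomial.X j - MvPolynomial.C (Complex.I * (t j : ℂ))) ^ (k j - 2))

/-- The multiperiod polynomial `P_{f₁,…,fₙ}`: the polynomial-valued integral of
`periodIntegrand` over `0 < t₁ < ⋯ < tₙ`, taken coefficient by coefficient. The sum runs over all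
exponents `α` with `0 ≤ α_j ≤ k_j - 2`. -/
def multiperiodPolynomial {n : ℕ} (k : Fin n → ℕ) (f : ∀ j, LevelOneCuspForm (k j)) :
    MvPolynomial (Fin n) ℂ :=
  ∑ a : (∀ j, Fin (k j - 1)),
    MvPolynomial.monomial (Finsupp.equivFunOnFinite.symm fun j => (a j : ℕ))
      (∫ t in openChamber n,
        (periodIntegrand k f t).coeff (Finsupp.equivFunOnFinite.symm fun j => (a j : ℕ)))

/-- `P^σ_{f₁,…,fₙ}(X₁, …, Xₙ) = P_{f_{σ(1)},…,f_{σ(n)}}(X_{σ(1)}, …, X_{σ(n)})`. -/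
def permutedPolynomial {n : ℕ} (k : Fin n → ℕ) (f : ∀ j, LevelOneCuspForm (k j))
    (σ : Equiv.Perm (Fin n)) : MvPolynomial (Fin n) ℂ :=
  MvPolynomial.rename σ (multiperiodPolynomial (fun j => k (σ j)) (fun j => f (σ j)))

end

/-!
The sum over `σ` of the permuted iterated Mellin transforms `Λ^σ(f₁, …, fₙ; m)` is the product
`∏ j, Λ(f_j; m_j)`: a permuted transform integrates the same integrand over a permuted chamber, and
the permuted chambers tile the positive orthant up to a null set (`sum_permutedLambda`). Hence the
family of all `Λ^σ` determines the tensor product of the period maps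
`f ↦ (Λ(f; m))_{1 ≤ m ≤ k - 1}`, and over a field a tensor product of injective maps is injective
(`injective_of_tprod_eq_prod`). This reduces the injectivity of the first map to a single cusp form.

For one cusp form `f` of even weight `k` the Eichler–Shimura argument applies. There are no nonzero
cusp forms of weight zero, so let `k ≥ 2`, and let `F` be the Eichler integral: up to a constant,
the `(k - 1)`-fold antiderivative of `f` vanishing at the cusp. In the parameter `q = exp (2πiz)` it is
obtained by inverting `q d/dq` repeatedly on functions vanishing at `q = 0`
(`exists_iterated_logDeriv_primitive`). Repeated integration by parts gives
`F(it) = c ∫_t^∞ f(iu) (u - t)^(k-2) du` with `c ≠ 0` (`integral_Ioi_sub_pow_mul_eq`). If all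
critical values of `f` vanish, this integral over `(t, ∞)` is minus the one over `(0, t)`, and the
substitution `u ↦ 1/u` turns it into `F(-1/z) = z^(2-k) F(z)` on the imaginary axis
(`integral_Ioi_sub_pow_mul_imAxisValue`). The identity theorem extends this to the upper
half-plane, so `F` is a modular form of level one and weight `2 - k ≤ 0` vanishing at the cusp
(`modularFormOfImAxis`). Such a form is zero, and therefore so is `f` (`cuspForm_eq_zero_of_moments`).

Finally, each coefficient of `P^σ` is a nonzero multiple of a value of `Λ^σ` at a critical
multi-integer, and all of these occur (`permutedPolynomial_eq_sum`). The second map is thus the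
first one followed by an injective linear map.
-/

noncomputable section

open MeasureTheory Filter Set Topology Asymptotics
open scoped ModularForm Manifold

/-! ### Iterated antiderivatives on a half-line -/

/-- A complex-valued version of `integrable_of_isBigO_exp_neg`. -/
lemma integrableOn_Ioi_of_isBigO_exp_neg {f : ℝ → ℂ} {a b : ℝ} (hb : 0 < b)
    (hf : ContinuousOn f (Ici a)) (ho : f =O[atTop] fun x => Real.exp (-b * x)) :
    IntegrableOn f (Ioi a) := by
  have hn : IntegrableOn (fun x => ‖f x‖) (Ioi a) :=
    integrable_of_isBigO_exp_neg hb hf.norm ho.norm_left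
  exact (integrable_norm_iff
    ((hf.mono Ioi_subset_Ici_self).aestronglyMeasurable measurableSet_Ioi)).1 hn

lemma isBigO_sub_pow_mul_of_isBigO_exp_neg {f : ℝ → ℂ} {b : ℝ} (hb : 0 < b)
    (ho : f =O[atTop] fun x => Real.exp (-b * x)) (t : ℝ) (j : ℕ) :
    (fun x : ℝ => ((x - t : ℝ) : ℂ) ^ j * f x) =O[atTop] fun x => Real.exp (-(b / 2) * x) := by
  have h1 : (fun x : ℝ => ((x - t : ℝ) : ℂ) ^ j) =O[atTop] fun x => Real.exp (b / 2 * x) := by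
    have h2 : (fun x : ℝ => ((x - t : ℝ) : ℂ)) =O[atTop] fun x : ℝ => x := by
      refine IsBigO.of_norm_left ?_
      simp only [Complex.norm_real]
      refine IsBigO.norm_left ?_
      exact (isBigO_refl _ _).sub (isLittleO_const_id_atTop t).isBigO
    exact (h2.pow j).trans (isLittleO_pow_exp_pos_mul_atTop j (half_pos hb)).isBigO
  refine (h1.mul ho).congr_right fun x => ?_
  rw [← Real.exp_add]; ring_nf

/-- Repeated integration by parts: in a chain of exponentially decaying functions in which each
`Φ (n + 1)` is an antiderivative of `-c * Φ n`, the truncated moments of `Φ n` are the later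
members of the chain. -/
theorem integral_Ioi_sub_pow_mul_eq {Φ : ℕ → ℝ → ℂ} {b : ℝ} {c : ℂ} (hb : 0 < b) (hc : c ≠ 0)
    (hcont : ∀ n, ContinuousOn (Φ n) (Ioi 0))
    (hderiv : ∀ n t, 0 < t → HasDerivAt (Φ (n + 1)) (-c * Φ n t) t)
    (hO : ∀ n, Φ n =O[atTop] fun x => Real.exp (-b * x)) (j : ℕ) :
    ∀ (n : ℕ) (t : ℝ), 0 < t →
      ∫ x in Ioi t, ((x - t : ℝ) : ℂ) ^ j * Φ n x =
        j.factorial / c ^ (j + 1) * Φ (n + j + 1) t := by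
  have hint : ∀ (i n : ℕ) (t : ℝ), 0 < t →
      IntegrableOn (fun x => ((x - t : ℝ) : ℂ) ^ i * Φ n x) (Ioi t) := fun i n t ht => by
    refine integrableOn_Ioi_of_isBigO_exp_neg (half_pos hb) ?_
      (isBigO_sub_pow_mul_of_isBigO_exp_neg hb (hO n) t i)
    refine ContinuousOn.mul (by fun_prop) ((hcont n).mono fun x hx => ht.trans_le hx)
  have hexp : ∀ {a : ℝ}, 0 < a → Tendsto (fun x : ℝ => Real.exp (-a * x)) atTop (𝓝 0) :=
    fun {a} ha => Real.tendsto_exp_atBot.comp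
      (tendsto_id.const_mul_atTop_of_neg (neg_lt_zero.2 ha))
  have hlim : ∀ (i n : ℕ) (t : ℝ),
      Tendsto (fun x => ((x - t : ℝ) : ℂ) ^ i * Φ n x) atTop (𝓝 0) := fun i n t =>
    (isBigO_sub_pow_mul_of_isBigO_exp_neg hb (hO n) t i).trans_tendsto (hexp (half_pos hb))
  induction j with
  | zero =>
    intro n t ht
    have h := integral_Ioi_of_hasDerivAt_of_tendsto (f := Φ (n + 1)) (f' := fun x => -c * Φ n x)
      (a := t) (m := 0)
      (hderiv n t ht).continuousAt.continuousWithinAt (fun x hx => hderiv n x (ht.trans hx))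
      (by simpa [IntegrableOn] using (hint 0 n t ht).const_mul (-c))
      (by simpa using hlim 0 (n + 1) t)
    rw [integral_const_mul] at h
    simp only [pow_zero, one_mul, Nat.factorial_zero, Nat.cast_one, zero_add, pow_one, add_zero]
    field_simp
    linear_combination -h
  | succ j ih =>
    intro n t ht
    have hu : ∀ x ∈ Ioi t, HasDerivAt (fun x : ℝ => ((x - t : ℝ) : ℂ) ^ (j + 1))
        ((j + 1 : ℕ) * ((x - t : ℝ) : ℂ) ^ j) x := fun x _ => by
      exact (((hasDerivAt_id x).sub_const t).ofReal_comp.pow (j + 1)).congr_deriv (by simp)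
    have h := integral_Ioi_mul_deriv_eq_deriv_mul (a := t) (a' := 0) (b' := 0)
      (u := fun x : ℝ => ((x - t : ℝ) : ℂ) ^ (j + 1)) (v := Φ (n + 1))
      (v' := fun x => -c * Φ n x) hu (fun x hx => hderiv n x (ht.trans hx)) ?_ ?_ ?_
      (hlim (j + 1) (n + 1) t)
    · have e1 : ∀ x : ℝ, ((x - t : ℝ) : ℂ) ^ (j + 1) * (-c * Φ n x)
          = -c * (((x - t : ℝ) : ℂ) ^ (j + 1) * Φ n x) := fun x => by ring
      have e2 : ∀ x : ℝ, ((j + 1 : ℕ) : ℂ) * ((x - t : ℝ) : ℂ) ^ j * Φ (n + 1) x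
          = ((j + 1 : ℕ) : ℂ) * (((x - t : ℝ) : ℂ) ^ j * Φ (n + 1) x) := fun x => by ring
      simp only [e1, e2, integral_const_mul, ih (n + 1) t ht] at h
      rw [show n + (j + 1) + 1 = n + 1 + j + 1 by ring, Nat.factorial_succ]
      push_cast at h ⊢
      field_simp at h ⊢
      linear_combination -h
    · refine ((hint (j + 1) n t ht).const_mul (-c)).congr (ae_of_all _ fun x => ?_)
      simp only [Pi.mul_apply]; ring
    · refine ((hint j (n + 1) t ht).const_mul ((j + 1 : ℕ) : ℂ)).congr (ae_of_all _ fun x => ?_)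
      simp only [Pi.mul_apply]; ring
    · have hcw : ContinuousAt (fun x : ℝ => ((x - t : ℝ) : ℂ) ^ (j + 1) * Φ (n + 1) x) t :=
        ContinuousAt.mul (by fun_prop) (hderiv n t ht).continuousAt
      have := hcw.tendsto
      simp only [sub_self, Complex.ofReal_zero, zero_pow (Nat.succ_ne_zero j), zero_mul] at this
      exact this.mono_left nhdsWithin_le_nhds

/-! ### The Eichler integral in the local parameter -/

/-- A holomorphic function on the unit disc vanishing at the origin lies in a chain of such
functions along which the operator `q d/dq` descends. -/
theorem exists_iterated_logDeriv_primitive {g : ℂ → ℂ}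
    (hg : DifferentiableOn ℂ g (Metric.ball 0 1)) (hg0 : g 0 = 0) :
    ∃ G : ℕ → ℂ → ℂ, G 0 = g ∧ (∀ n, DifferentiableOn ℂ (G n) (Metric.ball 0 1)) ∧
      (∀ n, G n 0 = 0) ∧
      ∀ n, ∀ q ∈ Metric.ball (0 : ℂ) 1, q * deriv (G (n + 1)) q = G n q := by
  let S := {g : ℂ → ℂ // DifferentiableOn ℂ g (Metric.ball 0 1) ∧ g 0 = 0}
  have step : ∀ g : S, ∃ G : S, ∀ q ∈ Metric.ball (0 : ℂ) 1, q * deriv G.1 q = g.1 q := by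
    rintro ⟨g, hg, hg0⟩
    have hd : DifferentiableOn ℂ (dslope g 0) (Metric.ball 0 1) :=
      (Complex.differentiableOn_dslope (Metric.ball_mem_nhds _ one_pos)).2 hg
    obtain ⟨G, hG0, hG⟩ := hd.isExactOn_ball.with_val_at 0 0
    refine ⟨⟨G, fun q hq => (hG q hq).differentiableAt.differentiableWithinAt, hG0⟩,
      fun q hq => ?_⟩
    have := sub_smul_dslope g 0 q
    simpa [hg0, (hG q hq).deriv] using this
  choose next hnext using step
  let H : ℕ → S := fun n => Nat.rec ⟨g, hg, hg0⟩ (fun _ s => next s) n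
  exact ⟨fun n => (H n).1, rfl, fun n => (H n).2.1, fun n => (H n).2.2, fun n => hnext (H n)⟩

/-! ### Cusp forms on the imaginary axis -/

lemma imAxisValue_of_pos {k : ℕ} (f : LevelOneCuspForm k) {t : ℝ} (ht : 0 < t) :
    imAxisValue f t = f ⟨Complex.I * t, by simpa using ht⟩ := by
  rw [imAxisValue, UpperHalfPlane.ofComplex_apply_of_im_pos]

@[simp]
lemma imAxisValue_zero {k : ℕ} (t : ℝ) : imAxisValue (0 : LevelOneCuspForm k) t = 0 := rfl

@[simp]
lemma imAxisValue_add {k : ℕ} (f g : LevelOneCuspForm k) (t : ℝ) :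
    imAxisValue (f + g) t = imAxisValue f t + imAxisValue g t := rfl

@[simp]
lemma imAxisValue_smul {k : ℕ} (c : ℂ) (f : LevelOneCuspForm k) (t : ℝ) :
    imAxisValue (c • f) t = c * imAxisValue f t := rfl

lemma slash_S_apply_I_mul (F : UpperHalfPlane → ℂ) (m : ℤ) {t : ℝ} (ht : 0 < t) :
    (F ∣[m] ModularGroup.S) ⟨Complex.I * t, by simpa using ht⟩ =
      F ⟨Complex.I * (t⁻¹ : ℝ), by simpa using ht⟩ * (Complex.I * t) ^ (-m) := by
  rw [SlashInvariantForm.slash_S_apply]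
  congr 2
  ext
  simp [mul_comm]

lemma imAxisValue_inv {k : ℕ} (f : LevelOneCuspForm k) {t : ℝ} (ht : 0 < t) :
    imAxisValue f t⁻¹ = (Complex.I * t) ^ k * imAxisValue f t := by
  have hS : ((⇑f : UpperHalfPlane → ℂ) ∣[(k : ℤ)] ModularGroup.S) = ⇑f :=
    SlashInvariantForm.slash_action_eqn f _ (MonoidHom.mem_range.mpr ⟨ModularGroup.S, rfl⟩)
  have h := congr_fun hS ⟨Complex.I * t, by simpa using ht⟩
  rw [slash_S_apply_I_mul _ _ ht] at h
  have h0 : (Complex.I * t : ℂ) ≠ 0 := by simp [ht.ne']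
  rw [imAxisValue_of_pos f ht, ← h, imAxisValue_of_pos f (inv_pos.2 ht), zpow_neg, zpow_natCast]
  field_simp

/-- A level one cusp form of weight zero is constant, with limit zero at the cusp. -/
theorem levelOneCuspForm_zero_eq_zero (f : LevelOneCuspForm 0) : f = 0 := by
  obtain ⟨c, hc⟩ : ∃ c, ⇑f = Function.const _ c :=
    ModularFormClass.levelOne_weight_zero_const (F := CuspForm 𝒮ℒ 0) f
  have hz : UpperHalfPlane.IsZeroAtImInfty f := CuspFormClass.zero_at_infty f
  have hc0 : c = 0 := by
    rw [hc] at hz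
    exact tendsto_nhds_unique tendsto_const_nhds hz
  ext z
  simp [hc, hc0]

theorem integrableOn_imAxisValue_mul_cpow {k : ℕ} (f : LevelOneCuspForm k) (s : ℂ) :
    IntegrableOn (fun t : ℝ => imAxisValue f t * (t : ℂ) ^ (s - 1)) (Ioi 0) := by
  rcases Nat.eq_zero_or_pos k with rfl | hk
  · rw [levelOneCuspForm_zero_eq_zero f]
    simp
  · have h := ((CuspForm.isStrongFEPair (k := (k : ℤ)) (mod_cast hk) f).hasMellin s).1
    refine h.congr_fun (fun t _ => ?_) measurableSet_Ioi
    simp [imAxisValue, ModularForm.weakFEPair, mul_comm]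

lemma integrableOn_imAxisValue_mul_pow {k : ℕ} (f : LevelOneCuspForm k) (c : ℕ) :
    IntegrableOn (fun t : ℝ => imAxisValue f t * (t : ℂ) ^ c) (Ioi 0) := by
  simpa using integrableOn_imAxisValue_mul_cpow f (c + 1)

/-! ### Injectivity of the period map of a single cusp form -/

lemma integral_imAxisValue_mul_sub_pow_eq_zero {k N : ℕ} {f : LevelOneCuspForm k}
    (h : ∀ c ≤ N, ∫ t in Ioi (0 : ℝ), imAxisValue f t * (t : ℂ) ^ c = 0) (t : ℝ) :
    IntegrableOn (fun x : ℝ => ((x - t : ℝ) : ℂ) ^ N * imAxisValue f x) (Ioi 0) ∧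
    ∫ x in Ioi (0 : ℝ), ((x - t : ℝ) : ℂ) ^ N * imAxisValue f x = 0 := by
  have e : (fun x : ℝ => ((x - t : ℝ) : ℂ) ^ N * imAxisValue f x) = fun x : ℝ =>
      ∑ c ∈ Finset.range (N + 1), (-(t : ℂ)) ^ (N - c) * (N.choose c) *
        (imAxisValue f x * (x : ℂ) ^ c) := by
    ext x
    rw [Complex.ofReal_sub, sub_eq_add_neg, add_pow, Finset.sum_mul]
    refine Finset.sum_congr rfl fun c _ => by ring
  have hi : ∀ c ∈ Finset.range (N + 1), Integrable (fun x : ℝ => (-(t : ℂ)) ^ (N - c) *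
      (N.choose c) * (imAxisValue f x * (x : ℂ) ^ c)) (volume.restrict (Ioi 0)) := fun c _ =>
    (integrableOn_imAxisValue_mul_pow f c).const_mul _
  rw [e]
  refine ⟨integrable_finsetSum _ hi, ?_⟩
  rw [integral_finsetSum _ hi]
  refine Finset.sum_eq_zero fun c hc => ?_
  rw [integral_const_mul, h c (by simpa [Nat.lt_succ_iff] using hc), mul_zero]

/-- If the moments of order at most `w` of `f(it)` vanish, the truncated moments satisfy the
functional equation of a form of weight `-w`: split the vanishing integral over `(0, ∞)` at `t`
and apply `t ↦ 1/t` to the first part. -/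
lemma integral_Ioi_sub_pow_mul_imAxisValue {w : ℕ} (hw : Even w) {f : LevelOneCuspForm (w + 2)}
    (h : ∀ c ≤ w, ∫ t in Ioi (0 : ℝ), imAxisValue f t * (t : ℂ) ^ c = 0) {t : ℝ} (ht : 0 < t) :
    ∫ x in Ioi t, ((x - t : ℝ) : ℂ) ^ w * imAxisValue f x =
      (Complex.I * t) ^ w * ∫ x in Ioi t⁻¹, ((x - t⁻¹ : ℝ) : ℂ) ^ w * imAxisValue f x := by
  obtain ⟨hi, h0⟩ := integral_imAxisValue_mul_sub_pow_eq_zero h t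
  set ψ : ℝ → ℂ := fun x => ((x - t : ℝ) : ℂ) ^ w * imAxisValue f x with hψ
  have hsplit : (∫ x in Ioo 0 t, ψ x) + ∫ x in Ioi t, ψ x = 0 := by
    rw [← integral_Ici_eq_integral_Ioi, ← setIntegral_union _ measurableSet_Ici
      (hi.mono_set Ioo_subset_Ioi_self) (hi.mono_set fun x hx => ht.trans_le hx),
      Ioo_union_Ici_eq_Ioi ht, h0]
    exact Set.disjoint_left.2 fun x hx hx' => (not_le.2 hx.2) hx'
  have hsub := integral_comp_rpow_Ioi ((Iio t).indicator ψ) (p := -1) (by norm_num)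
  rw [setIntegral_indicator measurableSet_Iio, Ioi_inter_Iio] at hsub
  have hre : ∫ x in Ioi (0 : ℝ), (|(-1 : ℝ)| * x ^ ((-1 : ℝ) - 1)) •
        (Iio t).indicator ψ (x ^ (-1 : ℝ)) =
      ∫ x in Ioi (0 : ℝ), (Ioi t⁻¹).indicator (fun x : ℝ => -((Complex.I * t) ^ w *
        (((x - t⁻¹ : ℝ) : ℂ) ^ w * imAxisValue f x))) x := by
    refine setIntegral_congr_fun measurableSet_Ioi fun x (hx : 0 < x) => ?_
    simp only [Real.rpow_neg_one]
    by_cases hxt : x⁻¹ < t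
    · have hxt' : t⁻¹ < x := inv_lt_of_inv_lt₀ hx hxt
      rw [indicator_of_mem (show x⁻¹ ∈ Iio t from hxt),
        indicator_of_mem (show x ∈ Ioi t⁻¹ from hxt'), hψ]
      simp only
      rw [imAxisValue_inv f hx, Complex.real_smul]
      have hx0 : (x : ℂ) ≠ 0 := by simp [hx.ne']
      have ht0 : (t : ℂ) ≠ 0 := by simp [ht.ne']
      have e1 : ((|(-1 : ℝ)| * x ^ ((-1 : ℝ) - 1) : ℝ) : ℂ) = ((x : ℂ) ^ 2)⁻¹ := by
        rw [show (-1 : ℝ) - 1 = -(2 : ℕ) by norm_num, Real.rpow_neg hx.le, Real.rpow_natCast]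
        simp
      -- `w` even absorbs the sign in `(x⁻¹ - t) * x = -((x - t⁻¹) * t)`
      have e2 : ((x⁻¹ - t : ℝ) : ℂ) ^ w * (x : ℂ) ^ w = ((x - t⁻¹ : ℝ) : ℂ) ^ w * (t : ℂ) ^ w := by
        rw [← mul_pow, ← mul_pow, ← hw.neg_pow]
        congr 1
        push_cast
        field_simp
        ring
      rw [e1, mul_pow Complex.I (t : ℂ), mul_pow Complex.I (x : ℂ), pow_add Complex.I,
        pow_add (x : ℂ), Complex.I_sq]
      generalize ((x⁻¹ - t : ℝ) : ℂ) ^ w = A at e2 ⊢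
      generalize ((x - t⁻¹ : ℝ) : ℂ) ^ w = B at e2 ⊢
      field_simp
      linear_combination (-(imAxisValue f x)) * e2
    · have hxt' : ¬ t⁻¹ < x := fun h => hxt (inv_lt_of_inv_lt₀ ht h)
      rw [indicator_of_notMem (show x⁻¹ ∉ Iio t from hxt),
        indicator_of_notMem (show x ∉ Ioi t⁻¹ from hxt'), smul_zero]
  rw [hre, setIntegral_indicator measurableSet_Ioi,
    inter_eq_self_of_subset_right (Ioi_subset_Ioi (inv_pos.2 ht).le), integral_neg,
    integral_const_mul] at hsub
  rw [← neg_eq_iff_add_eq_zero.2 hsplit, ← hsub, neg_neg]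

lemma qParam_one_I_mul (t : ℝ) :
    Function.Periodic.qParam 1 (Complex.I * t) = ((Real.exp (-2 * Real.pi * t) : ℝ) : ℂ) := by
  rw [Function.Periodic.qParam]
  push_cast
  congr 1
  linear_combination (2 * Real.pi * t : ℂ) * Complex.I_sq

lemma exp_mem_ball {t : ℝ} (ht : 0 < t) :
    ((Real.exp (-2 * Real.pi * t) : ℝ) : ℂ) ∈ Metric.ball (0 : ℂ) 1 := by
  rw [mem_ball_zero_iff, Complex.norm_real, Real.norm_eq_abs, abs_of_pos (Real.exp_pos _),
    Real.exp_lt_one_iff]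
  have := Real.pi_pos
  nlinarith

lemma hasDerivAt_comp_exp {G g : ℂ → ℂ} (hG : DifferentiableOn ℂ G (Metric.ball 0 1))
    (hd : ∀ q ∈ Metric.ball (0 : ℂ) 1, q * deriv G q = g q) {t : ℝ} (ht : 0 < t) :
    HasDerivAt (fun t : ℝ => G ((Real.exp (-2 * Real.pi * t) : ℝ) : ℂ))
      (-(2 * Real.pi : ℂ) * g ((Real.exp (-2 * Real.pi * t) : ℝ) : ℂ)) t := by
  have hq := exp_mem_ball ht
  have h1 : HasDerivAt (fun t : ℝ => ((Real.exp (-2 * Real.pi * t) : ℝ) : ℂ))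
      ((Real.exp (-2 * Real.pi * t) * (-2 * Real.pi) : ℝ) : ℂ) t := by
    have h2 : HasDerivAt (fun t : ℝ => -2 * Real.pi * t) (-2 * Real.pi) t := by
      simpa using (hasDerivAt_id t).const_mul (-2 * Real.pi)
    exact h2.exp.ofReal_comp
  have h3 := ((hG.differentiableAt (Metric.isOpen_ball.mem_nhds hq)).hasDerivAt).comp t h1
  refine h3.congr_deriv ?_
  rw [← hd _ hq]
  push_cast
  ring

lemma isBigO_comp_exp {G : ℂ → ℂ} (hG : DifferentiableOn ℂ G (Metric.ball 0 1)) (h0 : G 0 = 0) :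
    (fun t : ℝ => G ((Real.exp (-2 * Real.pi * t) : ℝ) : ℂ)) =O[atTop]
      fun t => Real.exp (-(2 * Real.pi) * t) := by
  have hO : G =O[𝓝 0] fun q : ℂ => q := by
    simpa [h0] using
      (hG.differentiableAt (Metric.ball_mem_nhds (0 : ℂ) one_pos)).isBigO_sub
  have hlim : Tendsto (fun t : ℝ => ((Real.exp (-2 * Real.pi * t) : ℝ) : ℂ)) atTop (𝓝 0) := by
    rw [← Complex.ofReal_zero]
    refine (Complex.continuous_ofReal.tendsto 0).comp (Real.tendsto_exp_atBot.comp
      (tendsto_id.const_mul_atTop_of_neg ?_))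
    have := Real.pi_pos
    linarith
  refine (hO.comp_tendsto hlim).trans (IsBigO.of_bound 1 (Eventually.of_forall fun t => ?_))
  simp only [Function.comp_def, Complex.norm_real, one_mul, neg_mul, le_refl]

open UpperHalfPlane in
/-- A holomorphic function on the upper half-plane that is invariant under `T` and satisfies the
transformation law under `S` along the imaginary axis is a modular form of level one, by the
identity theorem. -/
def modularFormOfImAxis (F : ℍ → ℂ) (m : ℤ) (hF : MDiff F) (hT : ∀ z : ℍ, F ((1 : ℝ) +ᵥ z) = F z)
    (hS : ∀ t : ℝ, ∀ ht : 0 < t, F ⟨Complex.I * (t⁻¹ : ℝ), by simpa using ht⟩ *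
      (Complex.I * t) ^ (-m) = F ⟨Complex.I * t, by simpa using ht⟩)
    (hbdd : IsBoundedAtImInfty F) : ModularForm 𝒮ℒ m :=
  have hS' : F ∣[m] ModularGroup.S = F := by
    have hd : MDiff (F ∣[m] ModularGroup.S) := hF.slash m _
    have key : EqOn ((F ∣[m] ModularGroup.S) ∘ ofComplex) (F ∘ ofComplex)
        {z : ℂ | 0 < z.im} := by
      have ho : IsOpen {z : ℂ | 0 < z.im} := isOpen_lt continuous_const Complex.continuous_im
      have hd' := (UpperHalfPlane.mdifferentiable_iff.1 hd).analyticOnNhd ho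
      have hF' := (UpperHalfPlane.mdifferentiable_iff.1 hF).analyticOnNhd ho
      refine hd'.eqOn_of_preconnected_of_frequently_eq hF'
        (convex_halfSpace_im_gt 0).isPreconnected (z₀ := Complex.I) (by simp) ?_
      -- the points `it` with `t → 1`, `t ≠ 1`, accumulate at `i`
      have hlim : Tendsto (fun t : ℝ => Complex.I * t) (𝓝[≠] 1) (𝓝[≠] Complex.I) := by
        refine tendsto_nhdsWithin_of_tendsto_nhds_of_eventually_within _ ?_ ?_
        · have : ContinuousAt (fun t : ℝ => Complex.I * t) 1 := by fun_prop
          simpa using this.tendsto.mono_left nhdsWithin_le_nhds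
        · filter_upwards [self_mem_nhdsWithin] with t ht h
          refine ht ?_
          simpa using h
      refine hlim.frequently (Eventually.frequently ?_)
      filter_upwards [nhdsWithin_le_nhds (Ioi_mem_nhds one_pos)] with t (ht : 0 < t)
      have him : 0 < (Complex.I * t : ℂ).im := by simpa using ht
      simp only [Function.comp_apply, ofComplex_apply_of_im_pos him]
      rw [slash_S_apply_I_mul F m ht, hS t ht]
    funext z
    simpa using key z.2
  have hT' : F ∣[m] ModularGroup.T = F := by
    funext z
    rw [ModularForm.SL_slash_apply, modular_T_smul, hT]
    simp [denom, ModularGroup.coe_T]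
  have hSL := SlashInvariantForm.slash_action_generators_SL2Z hS' hT'
  { toFun := F
    slash_action_eq' := fun _ ⟨γ, hγ⟩ => hγ ▸ hSL γ
    holo' := hF
    bdd_at_cusps' := fun hc => by
      rw [OnePoint.isBoundedAt_iff_forall_SL2Z hc]
      intro γ _
      rw [hSL γ]
      exact hbdd }

/-- A modular form of level one and nonpositive weight that vanishes at the cusp is zero. -/
lemma modularForm_eq_zero_of_nonpos_of_isZeroAtImInfty {m : ℤ} (hm : m ≤ 0) (F : ModularForm 𝒮ℒ m)
    (h0 : UpperHalfPlane.IsZeroAtImInfty F) : ⇑F = 0 := by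
  rcases hm.lt_or_eq with hm | rfl
  · exact ModularFormClass.levelOne_neg_weight_eq_zero hm F
  · obtain ⟨c, hc⟩ := ModularFormClass.levelOne_weight_zero_const F
    rw [hc] at h0 ⊢
    obtain rfl : c = 0 := tendsto_nhds_unique tendsto_const_nhds h0
    rfl

open UpperHalfPlane Function.Periodic in
/-- Injectivity of the Eichler–Shimura period map. When the moments of order at most `w` of `f(it)`
vanish, the Eichler integral of `f` is itself a modular form, of weight `-w`, and vanishes at the
cusp; it is therefore zero, and so is `f`. -/
theorem cuspForm_eq_zero_of_moments {w : ℕ} (hw : Even w) {f : LevelOneCuspForm (w + 2)}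
    (h : ∀ c ≤ w, ∫ t in Ioi (0 : ℝ), imAxisValue f t * (t : ℂ) ^ c = 0) : f = 0 := by
  obtain ⟨G, hGf, hGd, hG0, hG⟩ := exists_iterated_logDeriv_primitive
    (g := UpperHalfPlane.cuspFunction 1 f)
    (fun q hq => (ModularFormClass.differentiableAt_cuspFunction f one_pos one_mem_strictPeriods_SL
      (mem_ball_zero_iff.1 hq)).differentiableWithinAt)
    (CuspFormClass.cuspFunction_apply_zero f one_pos one_mem_strictPeriods_SL)
  have hf : ∀ z : ℍ, f z = G 0 (qParam 1 z) := fun z => by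
    rw [hGf, SlashInvariantFormClass.eq_cuspFunction f z one_mem_strictPeriods_SL one_ne_zero]
  have hball : ∀ z : ℂ, 0 < z.im → qParam 1 z ∈ Metric.ball (0 : ℂ) 1 := fun z hz =>
    mem_ball_zero_iff.2 (norm_qParam_lt_one one_pos hz)
  -- the Eichler integral of `f`, up to a constant
  let F : ℍ → ℂ := fun z => G (w + 1) (qParam 1 z)
  have hFax : ∀ t : ℝ, ∀ ht : 0 < t, F ⟨Complex.I * t, by simpa using ht⟩ =
      G (w + 1) ((Real.exp (-2 * Real.pi * t) : ℝ) : ℂ) := fun t ht => by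
    simp only [F, ← qParam_one_I_mul]
  have hpi : (2 * Real.pi : ℂ) ≠ 0 := by simp [Real.pi_ne_zero]
  have hEichler : ∀ t : ℝ, ∀ ht : 0 < t, ∫ x in Ioi t, ((x - t : ℝ) : ℂ) ^ w * imAxisValue f x =
      w.factorial / (2 * Real.pi : ℂ) ^ (w + 1) * F ⟨Complex.I * t, by simpa using ht⟩ := by
    intro t ht
    have := integral_Ioi_sub_pow_mul_eq
      (Φ := fun n t => G n ((Real.exp (-2 * Real.pi * t) : ℝ) : ℂ))
      (b := 2 * Real.pi) (c := 2 * Real.pi) (by positivity) hpi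
      (fun n => (hGd n).continuousOn.comp (by fun_prop) fun t ht => exp_mem_ball ht)
      (fun n t ht => hasDerivAt_comp_exp (hGd (n + 1)) (hG n) ht)
      (fun n => isBigO_comp_exp (hGd n) (hG0 n)) w 0 t ht
    rw [zero_add] at this
    rw [hFax t ht, ← this]
    refine setIntegral_congr_fun measurableSet_Ioi fun x (hx : t < x) => ?_
    rw [imAxisValue_of_pos f (ht.trans hx), hf, ← qParam_one_I_mul]
  have hMD : MDiff F := by
    rw [UpperHalfPlane.mdifferentiable_iff]
    have : DifferentiableOn ℂ (fun z : ℂ => G (w + 1) (qParam 1 z)) {z | 0 < z.im} :=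
      (hGd (w + 1)).comp differentiable_qParam.differentiableOn hball
    refine this.congr fun z hz => ?_
    simp [F, ofComplex_apply_of_im_pos hz]
  have hzero : IsZeroAtImInfty F := by
    have hc : ContinuousAt (G (w + 1)) 0 :=
      ((hGd (w + 1)).differentiableAt (Metric.ball_mem_nhds (0 : ℂ) one_pos)).continuousAt
    have := hc.tendsto.comp (qParam_tendsto_atImInfty one_pos)
    rw [hG0] at this
    exact this
  let M := modularFormOfImAxis F (-w) hMD
    (fun z => by
      simp only [F, qParam, coe_vadd]
      congr 1
      rw [Complex.exp_eq_exp_iff_exists_int]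
      refine ⟨1, ?_⟩
      push_cast
      ring)
    (fun t ht => by
      have h1 := integral_Ioi_sub_pow_mul_imAxisValue hw h ht
      rw [hEichler t ht, hEichler t⁻¹ (inv_pos.2 ht)] at h1
      have h2 : (w.factorial / (2 * Real.pi : ℂ) ^ (w + 1)) ≠ 0 :=
        div_ne_zero (mod_cast w.factorial_ne_zero) (pow_ne_zero _ hpi)
      rw [neg_neg, zpow_natCast]
      apply mul_left_cancel₀ h2
      linear_combination -h1)
    hzero.isBoundedAtImInfty
  have hF0 : ∀ z : ℍ, F z = 0 := congr_fun
    (modularForm_eq_zero_of_nonpos_of_isZeroAtImInfty (m := -w) (by simp) M hzero)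
  -- applying `q d/dq` repeatedly carries the vanishing of `G (w + 1)` down to `G 0`
  have hGz : ∀ n ≤ w + 1, ∀ q ∈ Metric.ball (0 : ℂ) 1, G n q = 0 := by
    intro n hn
    induction hn using Nat.decreasingInduction with
    | self =>
      intro q hq
      rcases eq_or_ne q 0 with rfl | hq0
      · exact hG0 _
      -- every point of the punctured disc is `exp (2πiz)` for some `z` in the upper half-plane
      · have := hF0 ⟨_, im_invQParam_pos_of_norm_lt_one one_pos (mem_ball_zero_iff.1 hq) hq0⟩
        simpa [F, qParam_right_inv one_ne_zero hq0] using this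
    | of_succ n hn ih =>
      intro q hq
      have hev : G (n + 1) =ᶠ[𝓝 q] fun _ => 0 := by
        filter_upwards [Metric.isOpen_ball.mem_nhds hq] with p hp using ih p hp
      rw [← hG n q hq, hev.deriv_eq]
      simp
  ext z
  rw [hf, hGz 0 (Nat.zero_le _) _ (hball _ z.2)]
  rfl

/-- The period map of a single cusp form of even weight, with values at all critical integers, is
injective. -/
theorem cuspForm_eq_zero_of_critical_moments {k : ℕ} (hk : Even k) {f : LevelOneCuspForm k}
    (h : ∀ c : Fin (k - 1), ∫ t in Ioi (0 : ℝ), imAxisValue f t * (t : ℂ) ^ (c : ℕ) = 0) :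
    f = 0 := by
  match k, hk, f, h with
  | 0, _, f, _ => exact levelOneCuspForm_zero_eq_zero f
  | 1, hk, _, _ => exact absurd hk (by decide)
  | w + 2, hk, f, h =>
    exact cuspForm_eq_zero_of_moments (by simpa [Nat.even_add] using hk)
      fun c hc => h ⟨c, by lia⟩

/-! ### Chambers -/

/-- The open chamber `0 < t_{σ(1)} < ⋯ < t_{σ(n)}`. -/
def permutedChamber {n : ℕ} (σ : Equiv.Perm (Fin n)) : Set (Fin n → ℝ) :=
  {t | t ∘ σ ∈ openChamber n}

lemma permutedChamber_subset {n : ℕ} (σ : Equiv.Perm (Fin n)) :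
    permutedChamber σ ⊆ univ.pi fun _ => Ioi 0 := fun t ht j _ => by
  simpa using ht.1 (σ.symm j)

lemma openChamber_subset (n : ℕ) : openChamber n ⊆ univ.pi fun _ => Ioi 0 :=
  fun _ ht j _ => ht.1 j

lemma measurableSet_openChamber (n : ℕ) : MeasurableSet (openChamber n) := by
  have : openChamber n = (⋂ j, {t : Fin n → ℝ | 0 < t j}) ∩
      ⋂ i, ⋂ j, ⋂ _ : i < j, {t : Fin n → ℝ | t i < t j} := by
    ext t
    simp [openChamber, StrictMono]
  rw [this]
  exact (MeasurableSet.iInter fun j =>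
    measurableSet_lt measurable_const (measurable_pi_apply j)).inter
    (MeasurableSet.iInter fun i => MeasurableSet.iInter fun j => MeasurableSet.iInter fun _ =>
      measurableSet_lt (measurable_pi_apply i) (measurable_pi_apply j))

lemma measurableSet_permutedChamber {n : ℕ} (σ : Equiv.Perm (Fin n)) :
    MeasurableSet (permutedChamber σ) :=
  (measurable_pi_lambda _ fun j => measurable_pi_apply (σ j) :
    Measurable fun t : Fin n → ℝ => t ∘ σ) (measurableSet_openChamber n)

lemma pairwise_disjoint_permutedChamber (n : ℕ) :
    Pairwise (Function.onFun Disjoint fun σ : Equiv.Perm (Fin n) => permutedChamber σ) := by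
  intro σ τ hne
  refine Set.disjoint_left.2 fun t hσ hτ => hne ?_
  have hr : range (t ∘ σ) = range (t ∘ τ) := by
    rw [σ.surjective.range_comp, τ.surjective.range_comp]
  have he : t ∘ σ = t ∘ τ := (hσ.2.range_inj hτ.2).1 hr
  have hinj : Function.Injective t := by
    have := hσ.2.injective.comp σ.symm.injective
    rwa [Function.comp_assoc, σ.self_comp_symm, Function.comp_id] at this
  exact Equiv.ext fun j => hinj (congr_fun he j)

lemma ae_injective (n : ℕ) : ∀ᵐ t : Fin n → ℝ, Function.Injective t := by
  have h : ∀ i j : Fin n, ∀ᵐ t : Fin n → ℝ, t i = t j → i = j := by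
    intro i j
    rcases eq_or_ne i j with rfl | hij
    · exact ae_of_all _ fun _ _ => rfl
    · let S : Submodule ℝ (Fin n → ℝ) :=
        LinearMap.ker (LinearMap.proj (R := ℝ) (φ := fun _ : Fin n => ℝ) i - LinearMap.proj j)
      have hS : S ≠ ⊤ := fun h => by
        have : (Pi.single i 1 : Fin n → ℝ) ∈ S := h ▸ Submodule.mem_top
        simp [S, hij.symm] at this
      have h0 := Measure.addHaar_submodule (volume : Measure (Fin n → ℝ)) S hS
      filter_upwards [measure_eq_zero_iff_ae_notMem.1 h0] with t ht he
      exact absurd (by simp [S, he]) ht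
  filter_upwards [ae_all_iff.2 fun i => ae_all_iff.2 (h i)] with t ht i j using ht i j

/-- The permuted chambers tile the positive orthant up to the null set of tuples with a repeated
entry. -/
lemma iUnion_permutedChamber_ae_eq (n : ℕ) :
    (⋃ σ : Equiv.Perm (Fin n), permutedChamber σ) =ᵐ[volume]
      (univ.pi fun _ => Ioi 0 : Set (Fin n → ℝ)) := by
  filter_upwards [ae_injective n] with t ht
  refine propext ⟨fun h => iUnion_subset permutedChamber_subset h, fun h => ?_⟩
  exact mem_iUnion.2 ⟨Tuple.sort t, fun j => h _ (mem_univ _),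
    (Tuple.monotone_sort t).strictMono_of_injective (ht.comp (Tuple.sort t).injective)⟩

/-! ### Iterated Mellin transforms -/

lemma integrableOn_pi_mellinIntegrand {n : ℕ} (k : Fin n → ℕ) (f : ∀ j, LevelOneCuspForm (k j))
    (s : Fin n → ℂ) : IntegrableOn (mellinIntegrand k f s) (univ.pi fun _ => Ioi 0) := by
  rw [IntegrableOn, volume_pi, Measure.restrict_pi_pi]
  exact Integrable.fintype_prod (f := fun j (t : ℝ) => imAxisValue (f j) t * (t : ℂ) ^ (s j - 1))
    fun j => integrableOn_imAxisValue_mul_cpow (f j) (s j)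

lemma integral_pi_mellinIntegrand {n : ℕ} (k : Fin n → ℕ) (f : ∀ j, LevelOneCuspForm (k j))
    (s : Fin n → ℂ) : ∫ t in univ.pi fun _ => Ioi 0, mellinIntegrand k f s t =
      ∏ j, ∫ t in Ioi (0 : ℝ), imAxisValue (f j) t * (t : ℂ) ^ (s j - 1) := by
  rw [volume_pi, Measure.restrict_pi_pi]
  exact integral_fintype_prod_eq_prod
    fun j (t : ℝ) => imAxisValue (f j) t * (t : ℂ) ^ (s j - 1)

/-- Permuting the arguments of the iterated Mellin transform amounts to integrating the same
integrand over another chamber. -/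
lemma permutedLambda_eq_integral_permutedChamber {n : ℕ} (k : Fin n → ℕ)
    (f : ∀ j, LevelOneCuspForm (k j)) (σ : Equiv.Perm (Fin n)) (s : Fin n → ℂ) :
    permutedLambda k f σ s = ∫ t in permutedChamber σ, mellinIntegrand k f s t := by
  let T := MeasurableEquiv.piCongrLeft (fun _ : Fin n => ℝ) σ.symm
  have hT : ∀ t, T t = t ∘ σ := fun t => funext fun j => by
    obtain ⟨i, rfl⟩ := σ.symm.surjective j
    simp [T, MeasurableEquiv.coe_piCongrLeft, Equiv.piCongrLeft_apply_apply]
  have h := (volume_measurePreserving_piCongrLeft (fun _ : Fin n => ℝ)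
    σ.symm).setIntegral_preimage_emb T.measurableEmbedding
    (mellinIntegrand (fun j => k (σ j)) (fun j => f (σ j)) (fun j => s (σ j))) (openChamber n)
  rw [permutedLambda, iteratedLambda, ← h]
  have hpre : (T ⁻¹' openChamber n) = permutedChamber σ := by
    ext t
    simp [hT, permutedChamber]
  change ∫ t in T ⁻¹' openChamber n, _ = _
  rw [hpre]
  refine integral_congr_ae (ae_of_all _ fun t => ?_)
  change mellinIntegrand _ _ _ (T t) = _
  rw [hT]
  exact Equiv.prod_comp σ fun j => imAxisValue (f j) (t j) * (t j : ℂ) ^ (s j - 1)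

/-- The permuted iterated Mellin transforms add up to the product of the individual ones, because
the chambers tile the orthant. -/
theorem sum_permutedLambda {n : ℕ} (k : Fin n → ℕ) (f : ∀ j, LevelOneCuspForm (k j))
    (s : Fin n → ℂ) : ∑ σ, permutedLambda k f σ s =
      ∏ j, ∫ t in Ioi (0 : ℝ), imAxisValue (f j) t * (t : ℂ) ^ (s j - 1) := by
  simp_rw [permutedLambda_eq_integral_permutedChamber]
  rw [← integral_iUnion_fintype measurableSet_permutedChamber
    (pairwise_disjoint_permutedChamber n) fun σ =>
      (integrableOn_pi_mellinIntegrand k f s).mono_set (permutedChamber_subset σ),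
    setIntegral_congr_set (iUnion_permutedChamber_ae_eq n), integral_pi_mellinIntegrand]

/-- `mellinIntegrand` as a multilinear function of the cusp forms. -/
def mellinIntegrandMultilinear {n : ℕ} (k : Fin n → ℕ) (s : Fin n → ℂ) (t : Fin n → ℝ) :
    MultilinearMap ℂ (fun j => LevelOneCuspForm (k j)) ℂ :=
  (MultilinearMap.mkPiAlgebra ℂ (Fin n) ℂ).compLinearMap fun j =>
    { toFun := fun f => imAxisValue f (t j) * (t j : ℂ) ^ (s j - 1)
      map_add' := fun f g => by rw [imAxisValue_add, add_mul]
      map_smul' := fun c f => by rw [imAxisValue_smul, mul_assoc]; rfl }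

lemma mellinIntegrandMultilinear_apply {n : ℕ} (k : Fin n → ℕ) (f : ∀ j, LevelOneCuspForm (k j))
    (s : Fin n → ℂ) (t : Fin n → ℝ) :
    mellinIntegrandMultilinear k s t f = mellinIntegrand k f s t := rfl

/-- `permutedLambda` as a multilinear function of the cusp forms. -/
def permutedLambdaMultilinear {n : ℕ} (k : Fin n → ℕ) (σ : Equiv.Perm (Fin n)) (s : Fin n → ℂ) :
    MultilinearMap ℂ (fun j => LevelOneCuspForm (k j)) ℂ where
  toFun f := permutedLambda k f σ s
  map_update_add' f i x y := by
    have hi := fun z => (integrableOn_pi_mellinIntegrand k (Function.update f i z) s).mono_set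
      (permutedChamber_subset σ)
    obtain rfl : ‹DecidableEq (Fin n)› = instDecidableEqFin n := Subsingleton.elim _ _
    simp_rw [permutedLambda_eq_integral_permutedChamber]
    rw [← integral_add (hi x) (hi y)]
    simp_rw [← mellinIntegrandMultilinear_apply, MultilinearMap.map_update_add]
  map_update_smul' f i c x := by
    obtain rfl : ‹DecidableEq (Fin n)› = instDecidableEqFin n := Subsingleton.elim _ _
    simp_rw [permutedLambda_eq_integral_permutedChamber]
    simp_rw [← mellinIntegrandMultilinear_apply, MultilinearMap.map_update_smul]
    rw [integral_smul]

/-! ### Tensor products of injective period maps -/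

/-- Over a field, a linear map out of a tensor product that is the product of injective coordinate
maps on pure tensors is injective: left inverses of the factors assemble to a left inverse. -/
theorem injective_of_tprod_eq_prod {K ι : Type*} [Field K] [Fintype ι] {V : ι → Type*}
    [∀ j, AddCommGroup (V j)] [∀ j, Module K (V j)] {C : ι → Type*} [∀ j, Fintype (C j)]
    (r : ∀ j, V j →ₗ[K] (C j → K)) (hr : ∀ j, Function.Injective (r j))
    (T : (⨂[K] j, V j) →ₗ[K] ((∀ j, C j) → K))
    (hT : ∀ f c, T (PiTensorProduct.tprod K f) c = ∏ j, r j (f j) (c j)) :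
    Function.Injective T := by
  classical
  choose l hl using fun j => LinearMap.exists_leftInverse_of_injective (r j)
    (LinearMap.ker_eq_bot.2 (hr j))
  let T' : ((∀ j, C j) → K) →ₗ[K] (⨂[K] j, V j) :=
    Fintype.linearCombination K fun c => PiTensorProduct.tprod K fun j => l j (Pi.single (c j) 1)
  have h : T' ∘ₗ T = LinearMap.id := by
    refine PiTensorProduct.ext (MultilinearMap.ext fun f => ?_)
    -- expand each `r j (f j)` in the standard basis of `C j → K`
    have hf : f = fun j => ∑ c, r j (f j) c • l j (Pi.single c 1) := funext fun j => by
      have h1 := LinearMap.congr_fun (hl j) (f j)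
      rw [LinearMap.comp_apply, pi_eq_sum_univ' (r j (f j)), map_sum] at h1
      simp only [map_smul] at h1
      exact h1.symm
    simp only [LinearMap.compMultilinearMap_apply, LinearMap.comp_apply, LinearMap.id_apply]
    conv_rhs => rw [hf]
    rw [MultilinearMap.map_sum]
    simp only [T', Fintype.linearCombination_apply, hT, MultilinearMap.map_smul_univ]
  exact Function.LeftInverse.injective (g := T') fun x => LinearMap.congr_fun h x

/-- The moments of order at most `k - 2` of a cusp form of weight `k` on the imaginary axis, that
is, its completed `L`-values at the critical integers. -/
def criticalMoments (k : ℕ) : LevelOneCuspForm k →ₗ[ℂ] (Fin (k - 1) → ℂ) where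
  toFun f c := ∫ t in Ioi (0 : ℝ), imAxisValue f t * (t : ℂ) ^ (c : ℕ)
  map_add' f g := funext fun c => by
    simp only [imAxisValue_add, add_mul, Pi.add_apply]
    exact integral_add (integrableOn_imAxisValue_mul_pow f c) (integrableOn_imAxisValue_mul_pow g c)
  map_smul' a f := funext fun c => by
    simp only [imAxisValue_smul, mul_assoc, integral_const_mul, Pi.smul_apply, smul_eq_mul,
      RingHom.id_apply]

lemma injective_criticalMoments {k : ℕ} (hk : Even k) : Function.Injective (criticalMoments k) :=
  (injective_iff_map_eq_zero _).2 fun _ hf =>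
    cuspForm_eq_zero_of_critical_moments hk fun c => congr_fun hf c

/-- The linear map `f₁ ⊗ ⋯ ⊗ fₙ ↦ (Λ^σ(f₁, …, fₙ; m))_{σ, m}`. -/
def lambdaMap {n : ℕ} (k : Fin n → ℕ) :
    (⨂[ℂ] j, LevelOneCuspForm (k j)) →ₗ[ℂ] (Equiv.Perm (Fin n) → CriticalIndex k → ℂ) :=
  LinearMap.pi fun σ => LinearMap.pi fun m =>
    PiTensorProduct.lift (permutedLambdaMultilinear k σ fun j => (m.1 j : ℂ))

lemma lambdaMap_tprod {n : ℕ} (k : Fin n → ℕ) (f : ∀ j, LevelOneCuspForm (k j))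
    (σ : Equiv.Perm (Fin n)) (m : CriticalIndex k) :
    lambdaMap k (PiTensorProduct.tprod ℂ f) σ m = permutedLambda k f σ fun j => (m.1 j : ℂ) := by
  simp only [lambdaMap, LinearMap.pi_apply, PiTensorProduct.lift.tprod]
  rfl

theorem injective_lambdaMap {n : ℕ} (k : Fin n → ℕ) (hk : ∀ j, Even (k j)) :
    Function.Injective (lambdaMap k) := by
  -- summing over `σ` leaves the tensor product of the period maps of the factors
  let ind : (∀ j, Fin (k j - 1)) → CriticalIndex k := fun c =>
    ⟨fun j => c j + 1, fun j => ⟨by lia, by have := (c j).2; lia⟩⟩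
  let T : (⨂[ℂ] j, LevelOneCuspForm (k j)) →ₗ[ℂ] ((∀ j, Fin (k j - 1)) → ℂ) :=
    LinearMap.pi fun c => ∑ σ, LinearMap.proj (ind c) ∘ₗ LinearMap.proj σ ∘ₗ lambdaMap k
  have hT : Function.Injective T := by
    refine injective_of_tprod_eq_prod (fun j => criticalMoments (k j))
      (fun j => injective_criticalMoments (hk j)) T fun f c => ?_
    simp only [T, LinearMap.pi_apply, LinearMap.sum_apply, LinearMap.comp_apply,
      LinearMap.proj_apply, lambdaMap_tprod, sum_permutedLambda]
    simp [ind, criticalMoments]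
  refine (injective_iff_map_eq_zero _).2 fun x hx => (injective_iff_map_eq_zero T).1 hT x ?_
  ext c
  simp [T, hx]

/-! ### Coefficients of the multiperiod polynomials -/

/-- The factor relating the coefficient of exponent `α` of the multiperiod polynomial to an iterated
Mellin transform. It is nonzero exactly when `α j ≤ k j - 2` for all `j`, with truncated
subtraction. -/
def periodFactor {n : ℕ} (k : Fin n → ℕ) (α : Fin n → ℕ) : ℂ :=
  ∏ j, ((k j - 2).choose (α j) : ℂ) * (-Complex.I) ^ (k j - 2 - α j)

/-- The `j`-th factor contributes the term `X_j ^ α j` of the binomial expansion of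
`(X_j - i t_j) ^ (k j - 2)`. When `α j` exceeds `k j - 2`, both sides vanish, the right-hand one
through the binomial coefficient. -/
lemma coeff_periodIntegrand {n : ℕ} (k : Fin n → ℕ) (f : ∀ j, LevelOneCuspForm (k j))
    (t : Fin n → ℝ) (α : Fin n →₀ ℕ) :
    (periodIntegrand k f t).coeff α =
      periodFactor k α * mellinIntegrand k f (fun j => ((k j - 2 - α j + 1 : ℕ) : ℂ)) t := by
  let a : Fin n → ℕ → ℂ := fun j i => imAxisValue (f j) (t j) *
    (((k j - 2).choose i : ℂ) * (-(Complex.I * t j)) ^ (k j - 2 - i))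
  have hfac : ∀ j, MvPolynomial.C (imAxisValue (f j) (t j)) *
      (MvPolynomial.X j - MvPolynomial.C (Complex.I * (t j : ℂ))) ^ (k j - 2) =
      ∑ i ∈ Finset.range (k j - 2 + 1), MvPolynomial.monomial (Finsupp.single j i) (a j i) := by
    intro j
    rw [sub_eq_add_neg, ← map_neg, add_pow, Finset.mul_sum]
    refine Finset.sum_congr rfl fun i _ => ?_
    rw [← map_pow, ← map_natCast (MvPolynomial.C (σ := Fin n) (R := ℂ)), mul_assoc, ← map_mul,
      mul_left_comm, ← map_mul, mul_comm, MvPolynomial.C_mul_X_pow_eq_monomial]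
    congr 1
    ring
  have hprod : ∀ b : Fin n → ℕ, ∏ j, MvPolynomial.monomial (Finsupp.single j (b j)) (a j (b j)) =
      MvPolynomial.monomial (Finsupp.equivFunOnFinite.symm b) (∏ j, a j (b j)) := by
    intro b
    rw [← Finsupp.univ_sum_single (Finsupp.equivFunOnFinite.symm b),
      MvPolynomial.monomial_sum_index, map_prod, ← Finset.prod_mul_distrib]
    refine Finset.prod_congr rfl fun j _ => ?_
    rw [MvPolynomial.C_mul_monomial, mul_one]
    rfl
  have hval : periodFactor k α * mellinIntegrand k f (fun j => ((k j - 2 - α j + 1 : ℕ) : ℂ)) t =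
      ∏ j, a j (α j) := by
    rw [periodFactor, mellinIntegrand, ← Finset.prod_mul_distrib]
    refine Finset.prod_congr rfl fun j _ => ?_
    simp only [a, Nat.cast_add, Nat.cast_one, add_sub_cancel_right, Complex.cpow_natCast]
    rw [← neg_mul, mul_pow]
    ring
  rw [hval, periodIntegrand]
  simp_rw [hfac]
  rw [Finset.prod_univ_sum]
  simp_rw [hprod]
  rw [MvPolynomial.coeff_sum]
  simp_rw [MvPolynomial.coeff_monomial]
  by_cases hα : (α : Fin n → ℕ) ∈ Fintype.piFinset fun j => Finset.range (k j - 2 + 1)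
  · rw [Finset.sum_eq_single (α : Fin n → ℕ)]
    · rw [if_pos]
      ext; rfl
    · intro b _ hb
      rw [if_neg]
      rintro rfl
      exact hb rfl
    · exact fun h => absurd hα h
  · rw [Finset.sum_eq_zero]
    · simp only [Fintype.mem_piFinset, Finset.mem_range, not_forall, not_lt] at hα
      obtain ⟨j, hj⟩ := hα
      refine (Finset.prod_eq_zero (Finset.mem_univ j) ?_).symm
      simp [a, Nat.choose_eq_zero_of_lt (Nat.lt_of_succ_le hj)]
    · intro b hb
      rw [if_neg]
      rintro rfl
      exact hα hb

lemma integral_coeff_periodIntegrand {n : ℕ} (k : Fin n → ℕ) (f : ∀ j, LevelOneCuspForm (k j))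
    (α : Fin n →₀ ℕ) : ∫ t in openChamber n, (periodIntegrand k f t).coeff α =
      periodFactor k α * iteratedLambda k f fun j => ((k j - 2 - α j + 1 : ℕ) : ℂ) := by
  simp_rw [coeff_periodIntegrand]
  rw [integral_const_mul]
  rfl

/-- The critical index whose iterated Mellin transform appears in the coefficient of
exponent `a`. -/
def criticalIndexOfExponent {n : ℕ} (k : Fin n → ℕ) (a : ∀ j, Fin (k j - 1)) : CriticalIndex k :=
  ⟨fun j => k j - 2 - a j + 1, fun j => ⟨by lia, by have := (a j).2; lia⟩⟩

lemma permutedPolynomial_eq_sum {n : ℕ} (k : Fin n → ℕ) (f : ∀ j, LevelOneCuspForm (k j))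
    (σ : Equiv.Perm (Fin n)) : permutedPolynomial k f σ = ∑ b : (∀ j, Fin (k j - 1)),
      MvPolynomial.monomial (Finsupp.equivFunOnFinite.symm fun j => (b j : ℕ))
        (periodFactor k (fun j => b j) *
          permutedLambda k f σ fun j => ((criticalIndexOfExponent k b).1 j : ℂ)) := by
  rw [permutedPolynomial, multiperiodPolynomial, map_sum,
    ← (Equiv.piCongrLeft (fun j => Fin (k j - 1)) σ).symm.sum_comp]
  refine Finset.sum_congr rfl fun b _ => ?_
  rw [MvPolynomial.rename_monomial, integral_coeff_periodIntegrand]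
  refine congr_arg₂ (fun d c => MvPolynomial.monomial d c) (Finsupp.ext fun j => ?_) ?_
  · obtain ⟨i, rfl⟩ := σ.surjective j
    rw [Finsupp.mapDomain_apply σ.injective]
    simp
  · congr 1
    exact Equiv.prod_comp σ fun j =>
      ((k j - 2).choose (b j) : ℂ) * (-Complex.I) ^ (k j - 2 - b j)

/-- The linear map that assembles a polynomial in `V_k` from values at the critical indices. -/
def polynomialOfCriticalValues {n : ℕ} (k : Fin n → ℕ) :
    (CriticalIndex k → ℂ) →ₗ[ℂ] multiperiodSpace k :=
  LinearMap.codRestrict _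
    (∑ b : (∀ j, Fin (k j - 1)),
      MvPolynomial.monomial (Finsupp.equivFunOnFinite.symm fun j => (b j : ℕ)) ∘ₗ
        (periodFactor k (fun j => b j) • LinearMap.proj (criticalIndexOfExponent k b)))
    fun v => by
      rw [LinearMap.sum_apply]
      refine Submodule.sum_mem _ fun b _ => ?_
      rw [multiperiodSpace, MvPolynomial.mem_restrictSupport_iff]
      refine (Finset.coe_subset.2 MvPolynomial.support_monomial_subset).trans ?_
      simp only [Finset.coe_singleton, singleton_subset_iff, mem_ofPred_eq]
      intro j
      have := (b j).2
      simp
      lia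

lemma coe_polynomialOfCriticalValues {n : ℕ} (k : Fin n → ℕ) (v : CriticalIndex k → ℂ) :
    (polynomialOfCriticalValues k v : MvPolynomial (Fin n) ℂ) = ∑ b : (∀ j, Fin (k j - 1)),
      MvPolynomial.monomial (Finsupp.equivFunOnFinite.symm fun j => (b j : ℕ))
        (periodFactor k (fun j => b j) * v (criticalIndexOfExponent k b)) := by
  simp [polynomialOfCriticalValues]

lemma injective_polynomialOfCriticalValues {n : ℕ} (k : Fin n → ℕ) :
    Function.Injective (polynomialOfCriticalValues k) := by
  refine (injective_iff_map_eq_zero _).2 fun v hv => funext fun m => ?_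
  let b : ∀ j, Fin (k j - 1) := fun j => ⟨k j - 1 - m.1 j, by have := m.2 j; lia⟩
  have hb : criticalIndexOfExponent k b = m := by
    refine Subtype.ext (funext fun j => ?_)
    have := m.2 j
    simp only [criticalIndexOfExponent, b]
    lia
  have hc : periodFactor k (fun j => b j) ≠ 0 := by
    refine Finset.prod_ne_zero_iff.2 fun j _ => mul_ne_zero ?_ (pow_ne_zero _ (by simp))
    have := (b j).2
    exact_mod_cast (Nat.choose_pos (by lia)).ne'
  have h := congr_arg (MvPolynomial.coeff (Finsupp.equivFunOnFinite.symm fun j => (b j : ℕ)))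
    ((coe_polynomialOfCriticalValues k v).symm.trans (congr_arg Subtype.val hv))
  rw [MvPolynomial.coeff_sum, Finset.sum_eq_single b] at h
  · simpa [hb, hc] using h
  · intro c _ hcb
    rw [MvPolynomial.coeff_monomial, if_neg]
    intro he
    refine hcb (funext fun j => Fin.ext ?_)
    exact congr_fun (Finsupp.equivFunOnFinite.symm.injective he) j
  · exact fun hn => absurd (Finset.mem_univ _) hn

end

theorem mainTheorem6 (n : ℕ) (k : Fin n → ℕ) (hk : ∀ j, Even (k j)) :
    -- the integrals that define the multiperiods and the multiperiod polynomial converge absolutely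
    (∀ (f : ∀ j, LevelOneCuspForm (k j)) (s : Fin n → ℂ),
      MeasureTheory.IntegrableOn (mellinIntegrand k f s) (openChamber n)) ∧
    (∀ (f : ∀ j, LevelOneCuspForm (k j)) (α : Fin n →₀ ℕ),
      MeasureTheory.IntegrableOn (fun t => (periodIntegrand k f t).coeff α) (openChamber n)) ∧
    -- the linear map to the family of permuted multiperiods is well defined and injective
    (∃ L : (⨂[ℂ] j, LevelOneCuspForm (k j)) →ₗ[ℂ]
        (Equiv.Perm (Fin n) → CriticalIndex k → ℂ),
      (∀ (f : ∀ j, LevelOneCuspForm (k j)) (σ : Equiv.Perm (Fin n)) (m : CriticalIndex k),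
        L (PiTensorProduct.tprod ℂ f) σ m = permutedLambda k f σ (fun j => (m.1 j : ℂ))) ∧
      Function.Injective L) ∧
    -- the linear map to the family of permuted multiperiod polynomials is well defined and injective
    (∃ R : (⨂[ℂ] j, LevelOneCuspForm (k j)) →ₗ[ℂ]
        (Equiv.Perm (Fin n) → multiperiodSpace k),
      (∀ (f : ∀ j, LevelOneCuspForm (k j)) (σ : Equiv.Perm (Fin n)),
        (R (PiTensorProduct.tprod ℂ f) σ : MvPolynomial (Fin n) ℂ) = permutedPolynomial k f σ) ∧
      Function.Injective R) := by
  refine ⟨fun f s => (integrableOn_pi_mellinIntegrand k f s).mono_set (openChamber_subset n),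
    fun f α => ?_, ⟨lambdaMap k, lambdaMap_tprod k, injective_lambdaMap k hk⟩,
    (polynomialOfCriticalValues k).compLeft _ ∘ₗ lambdaMap k, fun f σ => ?_, ?_⟩
  · simp_rw [coeff_periodIntegrand]
    exact ((integrableOn_pi_mellinIntegrand k f _).mono_set (openChamber_subset n)).const_mul _
  · rw [permutedPolynomial_eq_sum]
    refine (coe_polynomialOfCriticalValues k _).trans ?_
    simp_rw [lambdaMap_tprod]
  · exact (injective_polynomialOfCriticalValues k).comp_left.comp (injective_lambdaMap k hk)
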